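/- Let $\pi_1,\pi_2>0$, $\pi_3\in(-\pi_2,\pi_2)$, $n,p\in[1,\infty)$ (real), $A>0$, $\alpha\in(0,1)$ and $\alpha_c=1-\alpha$. Consider the autonomous system $\dot{\mathbf X}=f(\mathbf X)$ on $\mathbb R^3$, with state $\mathbf X=(X,Z,V)$, given by \[ \dot X=V,\qquad \dot Z=A\left(V-\pi_2|Z|^{n-1}Z|V|-\pi_3|Z|^nV\right),\qquad \dot V=-\alpha|X|^{p-1}X-\alpha_c|Z|^{p-1}Z-\pi_1|X|^pV . \] Put $\mathcal V(X,Z,V)=\frac{\alpha}{p+1}|X|^{p+1}+\frac{\alpha_c}{(p+1)A}|Z|^{p+1}+\frac12V^2$, $\mathcal S_{\mathbf Y}=\{\mathbf W\in\mathbb R^3:\mathcal V(\mathbf W)\le\mathcal V(\mathbf Y)\}$ for $\mathbf Y\in\mathbb R^3$, and $\mathcal E=\{(X,-(\alpha/\alpha_c)^{1/p}X,0):X\in\mathbb R\}$. Let $\mathbf X:[0,\infty)\to\mathbb R^3$ be any solution of this system (with arbitrary initial value) and let $\mathbf Y=\mathbf X(0)$. Let $\mathcal O^{+\infty}_{\mathbf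 Y}$ be its positive limit set, that is, the set of all $q\in\mathbb R^3$ for which there is a nondecreasing sequence of positive times $t_k\to\infty$ with $\mathbf X(t_k)\to q$. Then: (i) $\mathcal O^{+\infty}_{\mathbf Y}$ is nonempty and connected; (ii) $\mathcal O^{+\infty}_{\mathbf Y}$ is invariant, that is, every solution on $[0,\infty)$ starting in $\mathcal O^{+\infty}_{\mathbf Y}$ stays in it for all $t\ge0$, and for every $q\in\mathcal O^{+\infty}_{\mathbf Y}$ and $T\ge0$ there is a solution $x:[0,T]\to\mathcal O^{+\infty}_{\mathbf Y}$ with $x(T)=q$; (iii) $\mathbf X(t)$ converges to $\mathcal O^{+\infty}_{\mathbf Y}$ as $t\to\infty$, that is, for every $\varepsilon>0$ there is $T>0$ such that $\inf_{q\in\mathcal O^{+\infty}_{\mathbf Y}}\|\mathbf X(t)-q\|_2<\varepsilon$ for all $t>T$; (iv) $\mathcal O^{+\infty}_{\mathbf Y}\subseteq\mathcal S_{\mathbf Y}\cap\mathcal E$. -/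

import Mathlib

open Filter Topology

noncomputable section

namespace BoucWen

/-- `x` solves the autonomous system `x' = f(x)` on the set (interval) `I`. Only the values of `x`
on `I` matter: derivatives are taken within `I`, hence one-sided at an endpoint. -/
def IsSolutionOn {d : ℕ} (f : EuclideanSpace ℝ (Fin d) → EuclideanSpace ℝ (Fin d)) (I : Set ℝ)
    (x : ℝ → EuclideanSpace ℝ (Fin d)) : Prop :=
  ∀ t ∈ I, HasDerivWithinAt x (f (x t)) I t

/-- Every solution on `[0, ∞)` that starts in `U` stays in `U`. -/
def IsPositivelyInvariant {d : ℕ} (f : EuclideanSpace ℝ (Fin d) → EuclideanSpace ℝ (Fin d))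
    (U : Set (EuclideanSpace ℝ (Fin d))) : Prop :=
  ∀ x : ℝ → EuclideanSpace ℝ (Fin d), IsSolutionOn f (Set.Ici 0) x → x 0 ∈ U →
    ∀ t : ℝ, 0 ≤ t → x t ∈ U

/-- Every point of `U` is reached, after any prescribed time `T ≥ 0`, by a solution
`x : [0, T] → U`. -/
def IsNegativelyInvariant {d : ℕ} (f : EuclideanSpace ℝ (Fin d) → EuclideanSpace ℝ (Fin d))
    (U : Set (EuclideanSpace ℝ (Fin d))) : Prop :=
  ∀ z ∈ U, ∀ T : ℝ, 0 ≤ T → ∃ x : ℝ → EuclideanSpace ℝ (Fin d),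
    IsSolutionOn f (Set.Icc 0 T) x ∧ (∀ t ∈ Set.Icc 0 T, x t ∈ U) ∧ x T = z

/-- Invariance: positive and negative invariance. -/
def IsInvariantSet {d : ℕ} (f : EuclideanSpace ℝ (Fin d) → EuclideanSpace ℝ (Fin d))
    (U : Set (EuclideanSpace ℝ (Fin d))) : Prop :=
  IsPositivelyInvariant f U ∧ IsNegativelyInvariant f U

/-- The positive limit set of the trajectory `x : [0, ∞) → ℝᵈ`: all limits of `x (t k)` along
nondecreasing sequences of positive times `t k → ∞`. -/
def positiveLimitSet {d : ℕ} (x : ℝ → EuclideanSpace ℝ (Fin d)) :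
    Set (EuclideanSpace ℝ (Fin d)) :=
  {q | ∃ t : ℕ → ℝ, Monotone t ∧ (∀ k, 0 < t k) ∧ Tendsto t atTop atTop ∧
    Tendsto (fun k => x (t k)) atTop (𝓝 q)}

/-- The trajectory `x` converges to the set `S`: the Euclidean distance from `x t` to `S` tends
to zero as `t → ∞`. -/
def ConvergesToSet {d : ℕ} (x : ℝ → EuclideanSpace ℝ (Fin d))
    (S : Set (EuclideanSpace ℝ (Fin d))) : Prop :=
  ∀ ε : ℝ, 0 < ε → ∃ T : ℝ, 0 < T ∧ ∀ t : ℝ, T < t → Metric.infDist (x t) S < ε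

/-- The state function of the nondimensionalized Bouc-Wen-Simon-Hunt-Crossley collision model.
The coordinates of the state are `X = x 0`, `Z = x 1`, `V = x 2`, and `α_c = 1 - α`. -/
def stateFunction (π₁ π₂ π₃ n p α A : ℝ) (x : EuclideanSpace ℝ (Fin 3)) :
    EuclideanSpace ℝ (Fin 3) :=
  !₂[x 2,
    A * (x 2 - π₂ * |x 1| ^ (n - 1) * x 1 * |x 2| - π₃ * |x 1| ^ n * x 2),
    -(α * |x 0| ^ (p - 1) * x 0) - (1 - α) * |x 1| ^ (p - 1) * x 1 - π₁ * |x 0| ^ p * x 2]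

/-- The Lyapunov function of the model. -/
def lyapunov (p α A : ℝ) (x : EuclideanSpace ℝ (Fin 3)) : ℝ :=
  1 / (p + 1) * α * |x 0| ^ (p + 1) + 1 / (p + 1) * ((1 - α) / A) * |x 1| ^ (p + 1)
    + 1 / 2 * x 2 ^ 2

/-- The sublevel set of the Lyapunov function determined by the point `y`. -/
def sublevelSet (p α A : ℝ) (y : EuclideanSpace ℝ (Fin 3)) : Set (EuclideanSpace ℝ (Fin 3)) :=
  {x | lyapunov p α A x ≤ lyapunov p α A y}

/-- The equilibrium line `{(X, -(α/α_c)^(1/p) X, 0) : X ∈ ℝ}`. -/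
def equilibriumLine (p α : ℝ) : Set (EuclideanSpace ℝ (Fin 3)) :=
  {x | ∃ X : ℝ, x = !₂[X, -((α / (1 - α)) ^ (1 / p)) * X, 0]}

end BoucWen

end

/-! The Lyapunov function is nonincreasing along `X` and has compact sublevel sets, so the
trajectory is bounded. Compactness then makes the set of cluster points nonempty, connected and
attracting. Barbalat's lemma, in the form `IsSolutionOn.eq_zero_of_mapClusterPt`, takes the place of
LaSalle's argument: if a state function converges along the solution, its derivative vanishes at
limit points. Applied to the Lyapunov function, to `x 0 * x 2 ^ 2` and to `x 2`, it yields in turn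
`x 0 * x 2 = 0`, `x 2 = 0` and a vanishing acceleration. Every limit point is thus an equilibrium,
and invariance reduces to uniqueness of solutions for a locally Lipschitz field. -/

namespace BoucWen

/-! ### Cluster points of bounded trajectories -/

section Trajectories

variable {E : Type*} [MetricSpace E]

/-- A trajectory that eventually stays in a compact set eventually stays in every open
neighbourhood of its set of cluster points. -/
theorem eventually_mem_of_mapClusterPt_subset {x : ℝ → E} {c U : Set E} (hc : IsCompact c)
    (hxc : ∀ᶠ t in atTop, x t ∈ c) (hU : IsOpen U) (h : {q | MapClusterPt q atTop x} ⊆ U) :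
    ∀ᶠ t in atTop, x t ∈ U := by
  by_contra hcon
  have hf : ∃ᶠ t in atTop, x t ∈ c \ U :=
    ((not_eventually.1 hcon).and_eventually hxc).mono fun t ht => ⟨ht.2, ht.1⟩
  obtain ⟨q, hq, hqx⟩ := (hc.diff hU).exists_mapClusterPt_of_frequently hf
  exact hq.2 (h hqx)

/-- Two disjoint closed pieces would be compact, hence have disjoint open neighbourhoods. A tail of
the trajectory is connected, lies in their union and visits both, a contradiction. -/
theorem isPreconnected_setOf_mapClusterPt {x : ℝ → E} {c : Set E} (hc : IsCompact c)
    (hx : ContinuousOn x (Set.Ici 0)) (hxc : ∀ᶠ t in atTop, x t ∈ c) :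
    IsPreconnected {q | MapClusterPt q atTop x} := by
  have hcl : IsClosed {q | MapClusterPt q atTop x} := isClosed_setOfPred_clusterPt
  have hsub : {q | MapClusterPt q atTop x} ⊆ c := fun q hq =>
    hc.isClosed.mem_of_mapClusterPt hq hxc
  have hcpt : IsCompact {q | MapClusterPt q atTop x} := hc.of_isClosed_subset hcl hsub
  rw [isPreconnected_closed_iff]
  rintro t t' ht ht' hcover ⟨q, hq, hqt⟩ ⟨q', hq', hqt'⟩
  by_contra hempty
  rw [Set.not_nonempty_iff_eq_empty] at hempty
  have hdisj : Disjoint ({q | MapClusterPt q atTop x} ∩ t)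
      ({q | MapClusterPt q atTop x} ∩ t') := by
    rw [Set.disjoint_iff_inter_eq_empty, ← Set.inter_inter_distrib_left, hempty]
  obtain ⟨U, U', hU, hU', hsU, hsU', hUU'⟩ :=
    SeparatedNhds.of_isCompact_isCompact (hcpt.inter_right ht) (hcpt.inter_right ht') hdisj
  have hev := eventually_mem_of_mapClusterPt_subset hc hxc (hU.union hU') fun r hr =>
    (hcover hr).imp (fun h => hsU ⟨hr, h⟩) (fun h => hsU' ⟨hr, h⟩)
  obtain ⟨T, hT⟩ := eventually_atTop.1 (hev.and (eventually_ge_atTop 0))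
  have hpre : IsPreconnected (x '' Set.Ici T) :=
    isPreconnected_Ici.image x (hx.mono fun s hs => (hT s hs).2)
  have hmeet : ∀ {r : E} {W : Set E}, MapClusterPt r atTop x → IsOpen W → r ∈ W →
      (x '' Set.Ici T ∩ W).Nonempty := by
    intro r W hr hW hrW
    obtain ⟨s, hsW, hs⟩ := ((mapClusterPt_iff_frequently.1 hr W (hW.mem_nhds hrW)).and_eventually
      (eventually_ge_atTop T)).exists
    exact ⟨x s, ⟨s, hs, rfl⟩, hsW⟩
  obtain ⟨y, -, hyU, hyU'⟩ := hpre U U' hU hU'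
    (by rintro _ ⟨s, hs, rfl⟩; exact (hT s hs).1)
    (hmeet hq hU (hsU ⟨hq, hqt⟩)) (hmeet hq' hU' (hsU' ⟨hq', hqt'⟩))
  exact Set.disjoint_left.1 hUU' hyU hyU'

end Trajectories

theorem positiveLimitSet_eq_setOf_mapClusterPt {d : ℕ} (x : ℝ → EuclideanSpace ℝ (Fin d)) :
    positiveLimitSet x = {q | MapClusterPt q atTop x} := by
  ext q
  constructor
  · rintro ⟨t, -, -, ht, htq⟩
    exact htq.mapClusterPt.of_comp ht
  · intro hq
    have hne : (atTop ⊓ comap x (𝓝 q)).NeBot := by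
      rw [inf_comm, ← map_neBot_iff (f := x), Filter.push_pull']
      exact hq
    obtain ⟨t, ht⟩ := exists_seq_tendsto (atTop ⊓ comap x (𝓝 q))
    have ht1 : Tendsto t atTop atTop := ht.mono_right inf_le_left
    have ht2 : Tendsto (fun k => x (t k)) atTop (𝓝 q) :=
      tendsto_comap_iff.1 (ht.mono_right inf_le_right)
    -- Monotonicity comes from a subsequence, positivity from dropping its first `N` terms.
    obtain ⟨φ, hφ, htφ⟩ := strictMono_subseq_of_tendsto_atTop ht1
    have htop : Tendsto (t ∘ φ) atTop atTop := ht1.comp hφ.tendsto_atTop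
    obtain ⟨N, hN⟩ := eventually_atTop.1 (htop.eventually_gt_atTop 0)
    have hshift : Tendsto (fun k : ℕ => k + N) atTop atTop := tendsto_add_atTop_nat N
    exact ⟨fun k => t (φ (k + N)), fun a b hab => htφ.monotone (by lia),
      fun k => hN _ (by lia), htop.comp hshift, ht2.comp (hφ.tendsto_atTop.comp hshift)⟩

/-! ### Barbalat's lemma and bounded solutions -/

/-- Barbalat's lemma: if a function on `[0, ∞)` converges and its derivative is uniformly
continuous, then the derivative tends to zero. -/
theorem tendsto_zero_of_uniformContinuousOn_hasDerivWithinAt {φ ψ : ℝ → ℝ} {c : ℝ}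
    (hφ : ∀ t ∈ Set.Ici (0 : ℝ), HasDerivWithinAt φ (ψ t) (Set.Ici 0) t)
    (hψ : UniformContinuousOn ψ (Set.Ici 0)) (hc : Tendsto φ atTop (𝓝 c)) :
    Tendsto ψ atTop (𝓝 0) := by
  rw [Metric.tendsto_nhds]
  intro ε hε
  obtain ⟨δ, hδ, hψδ⟩ := Metric.uniformContinuousOn_iff.1 hψ (ε / 2) (half_pos hε)
  have hdiff : Tendsto (fun t => (φ (t + δ / 2) - φ t) / (δ / 2)) atTop (𝓝 0) := by
    have := ((hc.comp (tendsto_atTop_add_const_right atTop (δ / 2) tendsto_id)).sub hc).div_const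
      (δ / 2)
    simpa using this
  filter_upwards [Metric.tendsto_nhds.1 hdiff (ε / 2) (half_pos hε), eventually_ge_atTop 0]
    with t ht ht0
  -- The difference quotient equals `ψ s` at some `s` within `δ / 2` of `t`; uniform continuity
  -- carries its smallness over to `ψ t`.
  obtain ⟨s, hs, hslope⟩ := exists_hasDerivAt_eq_slope φ ψ (show t < t + δ / 2 by linarith)
    (fun s hs => ((hφ s (ht0.trans hs.1)).continuousWithinAt).mono
      fun r hr => ht0.trans hr.1)
    (fun s hs => (hφ s (ht0.trans hs.1.le)).hasDerivAt (Ici_mem_nhds (ht0.trans_lt hs.1)))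
  rw [add_sub_cancel_left] at hslope
  rw [← hslope] at ht
  have hts : dist t s < δ := by
    rw [Real.dist_eq, abs_lt]; constructor <;> linarith [hs.1, hs.2]
  calc dist (ψ t) 0 ≤ dist (ψ t) (ψ s) + dist (ψ s) 0 := dist_triangle _ _ _
    _ < ε / 2 + ε / 2 := add_lt_add (hψδ t ht0 s (ht0.trans hs.1.le) hts) ht
    _ = ε := add_halves ε

section BoundedSolutions

variable {d : ℕ} {f : EuclideanSpace ℝ (Fin d) → EuclideanSpace ℝ (Fin d)}
  {x : ℝ → EuclideanSpace ℝ (Fin d)} {c : Set (EuclideanSpace ℝ (Fin d))}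

theorem IsSolutionOn.continuousOn {I : Set ℝ} (hx : IsSolutionOn f I x) : ContinuousOn x I :=
  fun t ht => (hx t ht).continuousWithinAt

theorem IsSolutionOn.uniformContinuousOn (hx : IsSolutionOn f (Set.Ici 0) x) (hf : Continuous f)
    (hc : IsCompact c) (hxc : Set.MapsTo x (Set.Ici 0) c) :
    UniformContinuousOn x (Set.Ici 0) := by
  obtain ⟨C, hC⟩ := hc.exists_bound_of_continuousOn hf.continuousOn
  refine (Convex.lipschitzOnWith_of_nnnorm_hasDerivWithin_le (C := C.toNNReal) (convex_Ici 0) hx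
    fun t ht => ?_).uniformContinuousOn
  rw [← NNReal.coe_le_coe, coe_nnnorm]
  exact (hC _ (hxc ht)).trans (Real.le_coe_toNNReal C)

theorem eq_zero_of_mapClusterPt_of_tendsto {F : EuclideanSpace ℝ (Fin d) → ℝ} (hF : Continuous F)
    (h : Tendsto (fun t => F (x t)) atTop (𝓝 0)) {q : EuclideanSpace ℝ (Fin d)}
    (hq : MapClusterPt q atTop x) : F q = 0 := by
  have hmap : MapClusterPt (F q) atTop (F ∘ x) := hq.tendsto_comp (hF.tendsto q)
  have : (𝓝 (F q) ⊓ 𝓝 0).NeBot := hmap.neBot.mono (inf_le_inf_left _ h)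
  exact eq_of_nhds_neBot this

theorem tendsto_zero_of_eq_zero_of_mapClusterPt (hc : IsCompact c)
    (hxc : Set.MapsTo x (Set.Ici 0) c) {Φ : EuclideanSpace ℝ (Fin d) → ℝ} (hΦ : Continuous Φ)
    (h : ∀ q, MapClusterPt q atTop x → Φ q = 0) :
    Tendsto (fun t => Φ (x t)) atTop (𝓝 0) := by
  refine tendsto_def.2 fun s hs => ?_
  obtain ⟨u, hus, hu, h0⟩ := mem_nhds_iff.1 hs
  have := eventually_mem_of_mapClusterPt_subset hc
    ((eventually_ge_atTop 0).mono fun t ht => hxc ht) (hu.preimage hΦ)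
    fun q hq => by simpa [h q hq] using h0
  exact this.mono fun t ht => hus ht

/-- If `Φ` converges along a bounded solution, then its derivative along the solution vanishes on
the limit set. -/
theorem IsSolutionOn.eq_zero_of_mapClusterPt (hx : IsSolutionOn f (Set.Ici 0) x)
    (hf : Continuous f) (hc : IsCompact c) (hxc : Set.MapsTo x (Set.Ici 0) c)
    {Φ F : EuclideanSpace ℝ (Fin d) → ℝ} (hF : Continuous F)
    (hΦ : ∀ t ∈ Set.Ici (0 : ℝ), HasDerivWithinAt (fun s => Φ (x s)) (F (x t)) (Set.Ici 0) t)
    {a : ℝ} (ha : Tendsto (fun t => Φ (x t)) atTop (𝓝 a))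
    {q : EuclideanSpace ℝ (Fin d)} (hq : MapClusterPt q atTop x) : F q = 0 :=
  eq_zero_of_mapClusterPt_of_tendsto hF
    (tendsto_zero_of_uniformContinuousOn_hasDerivWithinAt hΦ
      ((hc.uniformContinuousOn_of_continuous hF.continuousOn).comp
        (hx.uniformContinuousOn hf hc hxc) hxc) ha) hq

theorem convergesToSet_setOf_mapClusterPt (hc : IsCompact c) (hxc : Set.MapsTo x (Set.Ici 0) c) :
    ConvergesToSet x {q | MapClusterPt q atTop x} := by
  intro ε hε
  have hev := eventually_mem_of_mapClusterPt_subset hc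
    ((eventually_ge_atTop 0).mono fun t ht => hxc ht)
    (U := {y | Metric.infDist y {q | MapClusterPt q atTop x} < ε})
    (isOpen_lt (Metric.continuous_infDist_pt _) continuous_const)
    fun q hq => by
      rw [Set.mem_ofPred_eq, Metric.infDist_zero_of_mem hq]
      exact hε
  obtain ⟨T, hT⟩ := eventually_atTop.1 hev
  exact ⟨max T 1, by positivity, fun t ht => hT t ((le_max_left _ _).trans ht.le)⟩

/-- A solution of a locally Lipschitz system that starts at an equilibrium is constant. -/
theorem IsSolutionOn.eq_of_equilibrium (hx : IsSolutionOn f (Set.Ici 0) x)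
    (hf : LocallyLipschitz f) (h0 : f (x 0) = 0) {t : ℝ} (ht : 0 ≤ t) : x t = x 0 := by
  have hcont : ContinuousOn x (Set.Icc 0 t) := hx.continuousOn.mono fun s hs => hs.1
  obtain ⟨K, hK⟩ := hf.locallyLipschitzOn.exists_lipschitzOnWith_of_compact
    (isCompact_Icc.image_of_continuousOn hcont)
  -- The field need only be Lipschitz on the compact arc of `x`, which also contains the constant
  -- solution `x 0`.
  refine ODE_solution_unique_of_mem_Icc_right (v := fun _ => f) (f := x) (g := fun _ => x 0)
    (s := fun _ => x '' Set.Icc 0 t)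
    (fun _ _ => hK) hcont (fun s hs => (hx s hs.1).mono fun r hr => hs.1.trans hr)
    (fun s hs => ⟨s, ⟨hs.1, hs.2.le⟩, rfl⟩) continuousOn_const (fun s _ => ?_)
    (fun s hs => ⟨0, ⟨le_rfl, ht⟩, rfl⟩) rfl ⟨ht, le_rfl⟩
  simpa only [h0] using hasDerivWithinAt_const s (Set.Ici s) (x 0)

/-- A set of equilibria of a locally Lipschitz system is invariant. -/
theorem isInvariantSet_of_equilibria (hf : LocallyLipschitz f)
    {U : Set (EuclideanSpace ℝ (Fin d))} (hU : ∀ q ∈ U, f q = 0) : IsInvariantSet f U := by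
  refine ⟨fun x hx hx0 t ht => ?_, fun z hz T hT => ⟨fun _ => z, fun t _ => ?_, fun _ _ => hz, rfl⟩⟩
  · rwa [hx.eq_of_equilibrium hf (hU _ hx0) ht]
  · simpa only [hU z hz] using hasDerivWithinAt_const t (Set.Icc 0 T) z

end BoundedSolutions

/-! ### Regularity of the power nonlinearities -/

theorem locallyLipschitz_mul {E : Type*} [PseudoEMetricSpace E] {f g : E → ℝ}
    (hf : LocallyLipschitz f) (hg : LocallyLipschitz g) : LocallyLipschitz fun x => f x * g x :=
  (contDiff_mul (𝕜 := ℝ) (𝔸 := ℝ) (n := 1)).locallyLipschitz.comp (hf.prodMk hg)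

theorem locallyLipschitz_abs : LocallyLipschitz fun x : ℝ => |x| :=
  (lipschitzWith_one_norm (E := ℝ)).locallyLipschitz

theorem locallyLipschitz_rpow {m : ℝ} (hm : 1 ≤ m) : LocallyLipschitz fun x : ℝ => x ^ m :=
  (Real.contDiff_rpow_const_of_le (n := 1) (by simpa using hm)).locallyLipschitz

theorem locallyLipschitz_abs_rpow {m : ℝ} (hm : 1 ≤ m) :
    LocallyLipschitz fun x : ℝ => |x| ^ m :=
  (locallyLipschitz_rpow hm).comp locallyLipschitz_abs

theorem abs_rpow_sub_one_mul_abs {m : ℝ} (hm : 0 < m) (x : ℝ) :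
    |x| ^ (m - 1) * |x| = |x| ^ m := by
  rcases eq_or_ne x 0 with rfl | hx
  · simp [Real.zero_rpow hm.ne']
  · rw [← Real.rpow_add_one (abs_ne_zero.2 hx), sub_add_cancel]

/-- The factor `|x| ^ (m - 1)` need not be locally Lipschitz when `m < 2`; splitting into positive
and negative parts leaves only exponents `m`. -/
theorem abs_rpow_sub_one_mul_self {m : ℝ} (hm : 0 < m) (x : ℝ) :
    |x| ^ (m - 1) * x = max x 0 ^ m - max (-x) 0 ^ m := by
  have h := abs_rpow_sub_one_mul_abs hm x
  rcases le_total 0 x with hx | hx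
  · rw [max_eq_left hx, max_eq_right (neg_nonpos.2 hx), Real.zero_rpow hm.ne', sub_zero]
    rwa [abs_of_nonneg hx] at h ⊢
  · rw [max_eq_right hx, max_eq_left (neg_nonneg.2 hx), Real.zero_rpow hm.ne', zero_sub]
    rw [abs_of_nonpos hx] at h ⊢
    linarith

theorem locallyLipschitz_abs_rpow_sub_one_mul_self {m : ℝ} (hm : 1 ≤ m) :
    LocallyLipschitz fun x : ℝ => |x| ^ (m - 1) * x := by
  have h : (fun x : ℝ => |x| ^ (m - 1) * x) = fun x => max x 0 ^ m - max (-x) 0 ^ m :=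
    funext fun x => abs_rpow_sub_one_mul_self (by linarith) x
  rw [h]
  exact ((locallyLipschitz_rpow hm).comp (LocallyLipschitz.id.max_const 0)).sub
    ((locallyLipschitz_rpow hm).comp (LocallyLipschitz.id.neg.max_const 0))

theorem abs_rpow_sub_one_mul_self_injective {m : ℝ} (hm : 0 < m) :
    Function.Injective fun x : ℝ => |x| ^ (m - 1) * x := by
  have habs : ∀ x : ℝ, |(|x| ^ (m - 1) * x)| = |x| ^ m := fun x => by
    rw [abs_mul, abs_of_nonneg (Real.rpow_nonneg (abs_nonneg x) _), abs_rpow_sub_one_mul_abs hm]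
  intro x y hxy
  simp only at hxy
  have h : |x| ^ m = |y| ^ m := by rw [← habs, ← habs, hxy]
  have hxy' : |x| = |y| := (Real.rpow_left_inj (abs_nonneg x) (abs_nonneg y) hm.ne').1 h
  rcases abs_eq_abs.1 hxy' with h' | h'
  · exact h'
  · have h0 : |x| ^ (m - 1) * x = 0 := by
      rw [← hxy', h'] at hxy
      rw [h']
      linarith
    have hx := habs x
    rw [h0, abs_zero, eq_comm, Real.rpow_eq_zero (abs_nonneg x) hm.ne', abs_eq_zero] at hx
    rw [hx] at h' ⊢
    linarith

theorem locallyLipschitz_stateFunction (π₁ π₂ π₃ α A : ℝ) {n p : ℝ} (hn : 1 ≤ n) (hp : 1 ≤ p) :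
    LocallyLipschitz (stateFunction π₁ π₂ π₃ n p α A) := by
  have hcoord : ∀ i, LocallyLipschitz fun x : EuclideanSpace ℝ (Fin 3) => x i := fun i =>
    (EuclideanSpace.proj (𝕜 := ℝ) i).lipschitz.locallyLipschitz
  have hmk : LocallyLipschitz fun y : ℝ × ℝ × ℝ =>
      (!₂[y.1, y.2.1, y.2.2] : EuclideanSpace ℝ (Fin 3)) := by
    apply ContDiff.locallyLipschitz (𝕂 := ℝ)
    rw [contDiff_euclidean]
    intro i
    fin_cases i
    · exact contDiff_fst
    · exact contDiff_fst.comp contDiff_snd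
    · exact contDiff_snd.comp contDiff_snd
  have hc : ∀ c : ℝ, LocallyLipschitz fun _ : EuclideanSpace ℝ (Fin 3) => c :=
    LocallyLipschitz.const
  have hs : ∀ {m : ℝ} (i : Fin 3), 1 ≤ m →
      LocallyLipschitz fun x : EuclideanSpace ℝ (Fin 3) => |x i| ^ (m - 1) * x i := fun i hm =>
    (locallyLipschitz_abs_rpow_sub_one_mul_self hm).comp (hcoord i)
  have ha : ∀ {m : ℝ} (i : Fin 3), 1 ≤ m →
      LocallyLipschitz fun x : EuclideanSpace ℝ (Fin 3) => |x i| ^ m := fun i hm =>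
    (locallyLipschitz_abs_rpow hm).comp (hcoord i)
  have hZ := locallyLipschitz_mul (hc A) (((hcoord 2).sub (locallyLipschitz_mul
    (locallyLipschitz_mul (hc π₂) (hs 1 hn)) (locallyLipschitz_abs.comp (hcoord 2)))).sub
    (locallyLipschitz_mul (locallyLipschitz_mul (hc π₃) (ha 1 hn)) (hcoord 2)))
  have hV := (((locallyLipschitz_mul (hc α) (hs 0 hp)).neg).sub
    (locallyLipschitz_mul (hc (1 - α)) (hs 1 hp))).sub
    (locallyLipschitz_mul (locallyLipschitz_mul (hc π₁) (ha 0 hp)) (hcoord 2))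
  convert hmk.comp ((hcoord 2).prodMk (hZ.prodMk hV)) using 1
  funext x
  simp [stateFunction, mul_assoc]

/-- The rate at which the Lyapunov function is dissipated. -/
noncomputable def dissipation (π₁ π₂ π₃ n p α : ℝ) (x : EuclideanSpace ℝ (Fin 3)) : ℝ :=
  (1 - α) * (|x 1| ^ (p - 1) * x 1) *
      (π₂ * (|x 1| ^ (n - 1) * x 1) * |x 2| + π₃ * |x 1| ^ n * x 2)
    + π₁ * |x 0| ^ p * x 2 ^ 2

theorem continuous_dissipation (π₁ π₂ π₃ α : ℝ) {n p : ℝ} (hn : 1 ≤ n) (hp : 1 ≤ p) :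
    Continuous (dissipation π₁ π₂ π₃ n p α) := by
  have hs : ∀ {m : ℝ} (i : Fin 3), 1 ≤ m →
      Continuous fun x : EuclideanSpace ℝ (Fin 3) => |x i| ^ (m - 1) * x i := fun i hm =>
    (locallyLipschitz_abs_rpow_sub_one_mul_self hm).continuous.comp
      (by fun_prop : Continuous fun x : EuclideanSpace ℝ (Fin 3) => x i)
  have ha : ∀ {m : ℝ} (i : Fin 3), 1 ≤ m →
      Continuous fun x : EuclideanSpace ℝ (Fin 3) => |x i| ^ m := fun i hm =>
    (locallyLipschitz_abs_rpow hm).continuous.comp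
      (by fun_prop : Continuous fun x : EuclideanSpace ℝ (Fin 3) => x i)
  have h1 := hs 1 hp
  have h2 := hs 1 hn
  have h3 := ha 1 hn
  have h4 := ha 0 hp
  unfold dissipation
  fun_prop

theorem continuous_lyapunov {p : ℝ} (hp : 1 ≤ p) (α A : ℝ) : Continuous (lyapunov p α A) := by
  have ha : ∀ i : Fin 3, Continuous fun x : EuclideanSpace ℝ (Fin 3) => |x i| ^ (p + 1) :=
    fun i => (locallyLipschitz_abs_rpow (by linarith : 1 ≤ p + 1)).continuous.comp
      (by fun_prop : Continuous fun x : EuclideanSpace ℝ (Fin 3) => x i)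
  have h0 := ha 0
  have h1 := ha 1
  unfold lyapunov
  fun_prop

/-! ### Sign and zeros of the dissipation -/

section Dissipation

variable {π₁ π₂ π₃ n p α : ℝ}

theorem hysteretic_dissipation_nonneg (hπ₃ : π₃ ∈ Set.Ioo (-π₂) π₂) (hn : 1 ≤ n)
    (hα : α ∈ Set.Ioo (0 : ℝ) 1) (z v : ℝ) :
    0 ≤ (1 - α) * (|z| ^ (p - 1) * z) * (π₂ * (|z| ^ (n - 1) * z) * |v| + π₃ * |z| ^ n * v) := by
  have hz : |z| ^ (n - 1) * z * z = |z| ^ n * |z| := by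
    rw [mul_assoc, ← abs_mul_abs_self, ← mul_assoc, abs_rpow_sub_one_mul_abs (by linarith)]
  -- This is where `|π₃| < π₂` enters: the remaining factor is `π₂ * |z * v| + π₃ * (z * v)`.
  have hsum : 0 ≤ π₂ * (|z| * |v|) + π₃ * (z * v) := by
    rw [← abs_mul]
    rcases abs_cases (z * v) with ⟨h, h'⟩ | ⟨h, h'⟩ <;> rw [h] <;> nlinarith [hπ₃.1, hπ₃.2]
  have hfac : (1 - α) * (|z| ^ (p - 1) * z) *
      (π₂ * (|z| ^ (n - 1) * z) * |v| + π₃ * |z| ^ n * v)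
      = (1 - α) * |z| ^ (p - 1) * |z| ^ n * (π₂ * (|z| * |v|) + π₃ * (z * v)) := by
    linear_combination (1 - α) * |z| ^ (p - 1) * π₂ * |v| * hz
  rw [hfac]
  have := sub_pos.2 hα.2
  positivity

theorem dissipation_nonneg (hπ₁ : 0 < π₁) (hπ₃ : π₃ ∈ Set.Ioo (-π₂) π₂) (hn : 1 ≤ n)
    (hα : α ∈ Set.Ioo (0 : ℝ) 1) (x : EuclideanSpace ℝ (Fin 3)) :
    0 ≤ dissipation π₁ π₂ π₃ n p α x :=
  add_nonneg (hysteretic_dissipation_nonneg hπ₃ hn hα _ _) (by positivity)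

/-- Only the viscous term is exploited; the hysteretic one merely has to be nonnegative. -/
theorem mul_eq_zero_of_dissipation_eq_zero (hπ₁ : 0 < π₁) (hπ₃ : π₃ ∈ Set.Ioo (-π₂) π₂)
    (hn : 1 ≤ n) (hp : 1 ≤ p) (hα : α ∈ Set.Ioo (0 : ℝ) 1) {x : EuclideanSpace ℝ (Fin 3)}
    (hx : dissipation π₁ π₂ π₃ n p α x = 0) : x 0 * x 2 = 0 := by
  have h := ((add_eq_zero_iff_of_nonneg (hysteretic_dissipation_nonneg hπ₃ hn hα (x 1) (x 2))
    (by positivity : 0 ≤ π₁ * |x 0| ^ p * x 2 ^ 2)).1 hx).2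
  rcases mul_eq_zero.1 h with h | h
  · have h0 := (mul_eq_zero.1 h).resolve_left hπ₁.ne'
    rw [Real.rpow_eq_zero (abs_nonneg _) (by linarith), abs_eq_zero] at h0
    rw [h0, zero_mul]
  · rw [pow_eq_zero_iff two_ne_zero] at h
    rw [h, mul_zero]

end Dissipation

/-! ### Lyapunov estimates and limit points -/

section Solutions

variable {π₁ π₂ π₃ n p α A : ℝ} {X : ℝ → EuclideanSpace ℝ (Fin 3)}

theorem IsSolutionOn.hasDerivWithinAt_apply {d : ℕ}
    {f : EuclideanSpace ℝ (Fin d) → EuclideanSpace ℝ (Fin d)} {I : Set ℝ}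
    {x : ℝ → EuclideanSpace ℝ (Fin d)} (hx : IsSolutionOn f I x) (i : Fin d) {t : ℝ}
    (ht : t ∈ I) : HasDerivWithinAt (fun s => x s i) (f (x t) i) I t :=
  (EuclideanSpace.proj (𝕜 := ℝ) i).hasFDerivAt.comp_hasDerivWithinAt t (hx t ht)

/-- The conservative power terms cancel; the weight `(1 - α) / A` absorbs the factor `A` in the
equation for `x 1`. -/
theorem IsSolutionOn.hasDerivWithinAt_lyapunov {I : Set ℝ} (hp : 1 ≤ p) (hA : 0 < A)
    (hX : IsSolutionOn (stateFunction π₁ π₂ π₃ n p α A) I X) {t : ℝ} (ht : t ∈ I) :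
    HasDerivWithinAt (fun s => lyapunov p α A (X s)) (-dissipation π₁ π₂ π₃ n p α (X t)) I t := by
  have habs : ∀ i, HasDerivWithinAt (fun s => |X s i| ^ (p + 1))
      ((p + 1) * |X t i| ^ (p - 1) * X t i * stateFunction π₁ π₂ π₃ n p α A (X t) i) I t := by
    intro i
    have h := (hasDerivAt_abs_rpow (X t i) (by linarith : 1 < p + 1)).comp_hasDerivWithinAt t
      (hX.hasDerivWithinAt_apply i ht)
    rwa [show p + 1 - 2 = p - 1 by ring] at h
  refine ((((habs 0).const_mul (1 / (p + 1) * α)).add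
    ((habs 1).const_mul (1 / (p + 1) * ((1 - α) / A)))).add
    (((hX.hasDerivWithinAt_apply 2 ht).pow 2).const_mul (1 / 2))).congr_deriv ?_
  have hp' : p + 1 ≠ 0 := by linarith
  have hA' := hA.ne'
  simp only [stateFunction, dissipation, PiLp.toLp_apply, Matrix.cons_val]
  field_simp
  ring

theorem isCompact_sublevelSet (hp : 1 ≤ p) (hα : α ∈ Set.Ioo (0 : ℝ) 1) (hA : 0 < A)
    (y : EuclideanSpace ℝ (Fin 3)) : IsCompact (sublevelSet p α A y) := by
  refine Metric.isCompact_of_isClosed_isBounded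
    (isClosed_le (continuous_lyapunov hp α A) continuous_const) ?_
  have hα' := sub_pos.2 hα.2
  have hα0 := hα.1
  have hp' : 0 < p + 1 := by linarith
  set L := lyapunov p α A y
  -- Either `|a| ≤ 1` or `|a| ≤ |a| ^ (p + 1)`, whence the sum of both bounds.
  have hbound : ∀ {a c : ℝ}, 0 < c → c * |a| ^ (p + 1) ≤ L → |a| ≤ 1 + L / c := by
    intro a c hc h
    have h1 : |a| ^ (p + 1) ≤ L / c := by rwa [le_div_iff₀' hc]
    rcases le_total |a| 1 with ha | ha
    · have : 0 ≤ |a| ^ (p + 1) := by positivity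
      linarith
    · have := Real.self_le_rpow_of_one_le ha (by linarith : 1 ≤ p + 1)
      linarith
  refine isBounded_iff_forall_norm_le.2
    ⟨(1 + L / (1 / (p + 1) * α)) + (1 + L / (1 / (p + 1) * ((1 - α) / A))) + (1 + 2 * L), ?_⟩
  intro x hx
  have hx' : 1 / (p + 1) * α * |x 0| ^ (p + 1) + 1 / (p + 1) * ((1 - α) / A) * |x 1| ^ (p + 1)
    + 1 / 2 * x 2 ^ 2 ≤ L := hx
  have t0 : 0 ≤ 1 / (p + 1) * α * |x 0| ^ (p + 1) := by positivity
  have t1 : 0 ≤ 1 / (p + 1) * ((1 - α) / A) * |x 1| ^ (p + 1) := by positivity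
  have t2 : 0 ≤ 1 / 2 * x 2 ^ 2 := by positivity
  have b0 : |x 0| ≤ _ := hbound (by positivity : 0 < 1 / (p + 1) * α) (by linarith)
  have b1 : |x 1| ≤ _ := hbound (by positivity : 0 < 1 / (p + 1) * ((1 - α) / A)) (by linarith)
  have b2 : |x 2| ≤ 1 + 2 * L := by nlinarith [sq_abs (x 2), sq_nonneg (|x 2| - 1)]
  have hnorm : ‖x‖ ≤ |x 0| + |x 1| + |x 2| := by
    rw [EuclideanSpace.norm_eq, Fin.sum_univ_three]
    refine Real.sqrt_le_iff.2 ⟨by positivity, ?_⟩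
    simp only [Real.norm_eq_abs]
    nlinarith [mul_nonneg (abs_nonneg (x 0)) (abs_nonneg (x 1)),
      mul_nonneg (abs_nonneg (x 0)) (abs_nonneg (x 2)),
      mul_nonneg (abs_nonneg (x 1)) (abs_nonneg (x 2))]
  linarith

theorem IsSolutionOn.antitoneOn_lyapunov (hπ₁ : 0 < π₁) (hπ₃ : π₃ ∈ Set.Ioo (-π₂) π₂)
    (hn : 1 ≤ n) (hp : 1 ≤ p) (hα : α ∈ Set.Ioo (0 : ℝ) 1) (hA : 0 < A)
    (hX : IsSolutionOn (stateFunction π₁ π₂ π₃ n p α A) (Set.Ici 0) X) :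
    AntitoneOn (fun t => lyapunov p α A (X t)) (Set.Ici 0) :=
  antitoneOn_of_hasDerivWithinAt_nonpos (convex_Ici 0)
    ((continuous_lyapunov hp α A).comp_continuousOn hX.continuousOn)
    (fun _ ht => (hX.hasDerivWithinAt_lyapunov hp hA (interior_subset ht)).mono interior_subset)
    (fun _ _ => neg_nonpos.2 (dissipation_nonneg hπ₁ hπ₃ hn hα _))

theorem lyapunov_nonneg (hp : 1 ≤ p) (hα : α ∈ Set.Ioo (0 : ℝ) 1) (hA : 0 < A)
    (x : EuclideanSpace ℝ (Fin 3)) : 0 ≤ lyapunov p α A x := by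
  have := sub_pos.2 hα.2
  have := hα.1
  unfold lyapunov
  positivity

theorem exists_tendsto_of_antitoneOn_Ici {φ : ℝ → ℝ} (hφ : AntitoneOn φ (Set.Ici 0))
    (h0 : ∀ t, 0 ≤ φ t) : ∃ a, Tendsto φ atTop (𝓝 a) := by
  have hanti : Antitone fun t => φ (max t 0) := fun s t hst =>
    hφ (le_max_right s 0) (le_max_right t 0) (max_le_max_right 0 hst)
  refine ⟨_, (tendsto_atTop_ciInf hanti ⟨0, ?_⟩).congr' ?_⟩
  · rintro _ ⟨t, rfl⟩
    exact h0 _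
  · filter_upwards [eventually_ge_atTop 0] with t ht
    rw [max_eq_left ht]

theorem mem_equilibriumLine (hp : 1 ≤ p) (hα : α ∈ Set.Ioo (0 : ℝ) 1)
    {x : EuclideanSpace ℝ (Fin 3)} (h2 : x 2 = 0)
    (hx : α * (|x 0| ^ (p - 1) * x 0) + (1 - α) * (|x 1| ^ (p - 1) * x 1) = 0) :
    x ∈ equilibriumLine p α := by
  have hα' := sub_pos.2 hα.2
  have hp' : 0 < p := by linarith
  set k := (α / (1 - α)) ^ (1 / p) with hk
  have hk0 : 0 < k := Real.rpow_pos_of_pos (div_pos hα.1 hα') _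
  have hkp : k ^ (p - 1) * k = α / (1 - α) := by
    rw [← Real.rpow_add_one hk0.ne', sub_add_cancel, hk,
      ← Real.rpow_mul (div_pos hα.1 hα').le, one_div_mul_cancel hp'.ne', Real.rpow_one]
  have h1 : x 1 = -k * x 0 := by
    apply abs_rpow_sub_one_mul_self_injective hp'
    simp only
    rw [abs_mul, abs_neg, abs_of_pos hk0, Real.mul_rpow hk0.le (abs_nonneg _)]
    have : |x 1| ^ (p - 1) * x 1 = -(α / (1 - α)) * (|x 0| ^ (p - 1) * x 0) := by
      field_simp
      linarith
    rw [this, ← hkp]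
    ring
  refine ⟨x 0, ?_⟩
  ext i
  fin_cases i
  · rfl
  · exact h1
  · exact h2

/-- The limit points of a solution are equilibria on the equilibrium line. -/
theorem IsSolutionOn.equilibrium_of_mapClusterPt (hπ₁ : 0 < π₁) (hπ₃ : π₃ ∈ Set.Ioo (-π₂) π₂)
    (hn : 1 ≤ n) (hp : 1 ≤ p) (hα : α ∈ Set.Ioo (0 : ℝ) 1) (hA : 0 < A)
    (hX : IsSolutionOn (stateFunction π₁ π₂ π₃ n p α A) (Set.Ici 0) X)
    {c : Set (EuclideanSpace ℝ (Fin 3))} (hc : IsCompact c) (hXc : Set.MapsTo X (Set.Ici 0) c)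
    {q : EuclideanSpace ℝ (Fin 3)} (hq : MapClusterPt q atTop X) :
    stateFunction π₁ π₂ π₃ n p α A q = 0 ∧ q ∈ equilibriumLine p α := by
  set f := stateFunction π₁ π₂ π₃ n p α A with hf_def
  have hf : Continuous f := (locallyLipschitz_stateFunction π₁ π₂ π₃ α A hn hp).continuous
  obtain ⟨a, ha⟩ := exists_tendsto_of_antitoneOn_Ici
    (hX.antitoneOn_lyapunov hπ₁ hπ₃ hn hp hα hA) fun t => lyapunov_nonneg hp hα hA (X t)
  have h02 : ∀ q, MapClusterPt q atTop X → q 0 * q 2 = 0 := fun q hq =>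
    mul_eq_zero_of_dissipation_eq_zero hπ₁ hπ₃ hn hp hα <| neg_eq_zero.1 <|
      hX.eq_zero_of_mapClusterPt hf hc hXc
        (F := fun x => -dissipation π₁ π₂ π₃ n p α x) (Φ := lyapunov p α A)
        (continuous_dissipation π₁ π₂ π₃ α hn hp).neg
        (fun t ht => hX.hasDerivWithinAt_lyapunov hp hA ht) ha hq
  have h2 : ∀ q, MapClusterPt q atTop X → q 2 = 0 := by
    intro q hq
    -- The derivative of `x 0 * x 2 ^ 2` is `x 2 ^ 3 + 2 * (x 0 * x 2) * f x 2`. At limit points the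
    -- second term is already zero, which leaves `x 2 ^ 3 = 0`.
    have hlim : Tendsto (fun t => X t 0 * X t 2 ^ 2) atTop (𝓝 0) :=
      tendsto_zero_of_eq_zero_of_mapClusterPt hc hXc (Φ := fun x => x 0 * x 2 ^ 2) (by fun_prop)
        fun r hr => by linear_combination r 2 * h02 r hr
    have h := hX.eq_zero_of_mapClusterPt hf hc hXc (Φ := fun x => x 0 * x 2 ^ 2)
      (F := fun x => x 2 ^ 3 + 2 * (x 0 * x 2) * f x 2) (by fun_prop)
      (fun t ht => ((hX.hasDerivWithinAt_apply 0 ht).mul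
        ((hX.hasDerivWithinAt_apply 2 ht).pow 2)).congr_deriv (by
          have h0 : f (X t) 0 = X t 2 := rfl
          rw [h0, Pi.pow_apply]; push_cast; ring)) hlim hq
    simpa [h02 q hq] using h
  -- The velocity now tends to zero, so its own derivative vanishes at limit points: this is the
  -- force balance defining the equilibrium line.
  have hf2 : f q 2 = 0 :=
    hX.eq_zero_of_mapClusterPt hf hc hXc (Φ := fun x => x 2) (F := fun x => f x 2) (by fun_prop)
      (fun t ht => hX.hasDerivWithinAt_apply 2 ht)
      (tendsto_zero_of_eq_zero_of_mapClusterPt hc hXc (by fun_prop) h2) hq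
  have hq2 := h2 q hq
  constructor
  · ext i
    fin_cases i
    · exact hq2
    · simp [hf_def, stateFunction, hq2]
    · exact hf2
  · refine mem_equilibriumLine hp hα hq2 ?_
    simp only [hf_def, stateFunction, PiLp.toLp_apply, Matrix.cons_val, hq2] at hf2
    linarith

end Solutions

end BoucWen

theorem mainTheorem2 (π₁ π₂ π₃ n p α A : ℝ)
    (hπ₁ : 0 < π₁) (hπ₂ : 0 < π₂) (hπ₃ : π₃ ∈ Set.Ioo (-π₂) π₂)
    (hn : 1 ≤ n) (hp : 1 ≤ p) (hα : α ∈ Set.Ioo (0 : ℝ) 1) (hA : 0 < A)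
    (X : ℝ → EuclideanSpace ℝ (Fin 3)) (Y : EuclideanSpace ℝ (Fin 3))
    (hX : BoucWen.IsSolutionOn (BoucWen.stateFunction π₁ π₂ π₃ n p α A) (Set.Ici 0) X)
    (hX0 : X 0 = Y) :
    (BoucWen.positiveLimitSet X).Nonempty ∧
    IsConnected (BoucWen.positiveLimitSet X) ∧
    BoucWen.IsInvariantSet (BoucWen.stateFunction π₁ π₂ π₃ n p α A)
      (BoucWen.positiveLimitSet X) ∧
    BoucWen.ConvergesToSet X (BoucWen.positiveLimitSet X) ∧
    BoucWen.positiveLimitSet X ⊆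
      BoucWen.sublevelSet p α A Y ∩ BoucWen.equilibriumLine p α := by
  subst hX0
  have hc := BoucWen.isCompact_sublevelSet hp hα hA (X 0)
  have hXc : Set.MapsTo X (Set.Ici 0) (BoucWen.sublevelSet p α A (X 0)) := fun t ht =>
    hX.antitoneOn_lyapunov hπ₁ hπ₃ hn hp hα hA Set.self_mem_Ici ht ht
  have hev : ∀ᶠ t in atTop, X t ∈ BoucWen.sublevelSet p α A (X 0) :=
    (eventually_ge_atTop 0).mono fun t ht => hXc ht
  rw [BoucWen.positiveLimitSet_eq_setOf_mapClusterPt]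
  have heq := fun q (hq : MapClusterPt q atTop X) =>
    hX.equilibrium_of_mapClusterPt hπ₁ hπ₃ hn hp hα hA hc hXc hq
  obtain ⟨q, -, hq⟩ := hc.exists_mapClusterPt_of_frequently hev.frequently
  exact ⟨⟨q, hq⟩,
    ⟨⟨q, hq⟩, BoucWen.isPreconnected_setOf_mapClusterPt hc hX.continuousOn hev⟩,
    BoucWen.isInvariantSet_of_equilibria
      (BoucWen.locallyLipschitz_stateFunction π₁ π₂ π₃ α A hn hp) fun q hq => (heq q hq).1,
    BoucWen.convergesToSet_setOf_mapClusterPt hc hXc,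
    fun q hq => ⟨hc.isClosed.mem_of_mapClusterPt hq hev, (heq q hq).2⟩⟩
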